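/- Let $p$ be a prime number and let $X$ be a scheme of characteristic $p$ (that is, $p=0$ in $\mathcal O_X$). Let $F\colon X\to X$ be the absolute Frobenius morphism, which is the identity on the underlying topological space and the $p$-th power map $\mathcal O_X\to F_*\mathcal O_X$ on sections. Assume that $X$ is Frobenius split, i.e. there is a morphism of $\mathcal O_X$-modules $\phi\colon F_*\mathcal O_X\to\mathcal O_X$ such that the composition $\mathcal O_X\to F_*\mathcal O_X\xrightarrow{\phi}\mathcal O_X$ is the identity. Let $\mathcal L$ be an invertible sheaf on $X$, and for $n\ge 0$ let $\mathcal L^n$ denote its $n$-th tensor power. Then: 1. for every $i\ge 0$, if there is an $N$ such that $H^i(X,\mathcal L^n)=0$ for all $n\ge N$, then $H^i(X,\mathcal L)=0$; 2. for every $e\ge 0$, the sheaf $\mathcal L$ is a direct summand, as an $\mathcal O_X$-module, of $F^e_*\mathcal L^{p^e}$, where $F^e$ is the $e$-th iterate of $F$. -/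

import Mathlib

open CategoryTheory AlgebraicGeometry TopologicalSpace

universe u

noncomputable section

namespace FrobeniusSplitting

/-- `X` is a scheme of characteristic `p` if `p = 0` in its structure sheaf. -/
def HasCharacteristic (p : ℕ) (X : Scheme.{u}) : Prop :=
  (p : Γ(X, ⊤)) = 0

lemma HasCharacteristic.cast_eq_zero {p : ℕ} {X : Scheme.{u}} (hX : HasCharacteristic p X)
    (U : X.Opens) : (p : Γ(X, U)) = 0 := by
  have h := congrArg (X.presheaf.map (homOfLE le_top : U ⟶ ⊤).op).hom hX
  simpa only [map_natCast, map_zero] using h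

/-- The `p`-th power map of a commutative ring in which the prime `p` is zero. -/
def powerHom (p : ℕ) [Fact p.Prime] (R : Type u) [CommRing R] (h : (p : R) = 0) : R →+* R where
  toFun a := a ^ p
  map_one' := one_pow p
  map_mul' a b := mul_pow a b p
  map_zero' := zero_pow (Fact.out : p.Prime).ne_zero
  map_add' a b := by
    obtain ⟨r, hr⟩ := exists_add_pow_prime_eq (Fact.out : p.Prime) a b
    rw [hr, h]
    ring

/-- The `p`-th power map on sections, as a map of the structure sheaf to its direct image under
the identity map of the underlying space. -/
def frobeniusSheafHom (p : ℕ) [Fact p.Prime] (X : Scheme.{u}) (hX : HasCharacteristic p X) :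
    X.presheaf ⟶ (TopCat.Presheaf.pushforward CommRingCat (𝟙 X.carrier)).obj X.presheaf where
  app U := CommRingCat.ofHom (powerHom p Γ(X, U.unop) (hX.cast_eq_zero U.unop))
  naturality U V i := by
    ext a
    exact (map_pow (X.presheaf.map i).hom a p).symm

/-- The (absolute) Frobenius morphism of a scheme of characteristic `p`: the identity map on
the underlying space and the `p`-th power map on sections of the structure sheaf. -/
def frobenius (p : ℕ) [Fact p.Prime] (X : Scheme.{u}) (hX : HasCharacteristic p X) : X ⟶ X where
  base := 𝟙 X.carrier
  c := frobeniusSheafHom p X hX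
  prop x := by
    constructor
    intro a ha
    obtain ⟨U, hxU, s, rfl⟩ := X.presheaf.exists_germ_eq a
    erw [PresheafedSpace.stalkMap_germ_apply] at ha
    have h : (X.presheaf.germ U x hxU).hom (s ^ p) =
        (X.presheaf.germ U x hxU).hom s ^ p := map_pow _ _ _
    change IsUnit ((X.presheaf.germ U x hxU).hom (s ^ p)) at ha
    rw [h] at ha
    exact (isUnit_pow_iff (Fact.out : p.Prime).ne_zero).1 ha

lemma frobenius_base (p : ℕ) [Fact p.Prime] (X : Scheme.{u}) (hX : HasCharacteristic p X) :
    (frobenius p X hX).base = 𝟙 X.carrier := rfl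

lemma frobenius_app (p : ℕ) [Fact p.Prime] (X : Scheme.{u}) (hX : HasCharacteristic p X)
    (U : X.Opens) (s : Γ(X, U)) : ((frobenius p X hX).app U).hom s = s ^ p := rfl

/-- The `e`-th iterate `F^e` of the Frobenius morphism. -/
def frobeniusIter (p : ℕ) [Fact p.Prime] (X : Scheme.{u}) (hX : HasCharacteristic p X) :
    ℕ → (X ⟶ X)
  | 0 => 𝟙 X
  | e + 1 => frobeniusIter p X hX e ≫ frobenius p X hX

/-- The structure sheaf, as a module over itself. -/
def structureModule (X : Scheme.{u}) : X.Modules :=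
  SheafOfModules.unit.{u} X.ringCatSheaf

/-- The map of `𝒪_Y`-modules `𝒪_Y ⟶ f_* 𝒪_X` belonging to a morphism `f : X ⟶ Y`. -/
def structureMap {X Y : Scheme.{u}} (f : X ⟶ Y) :
    structureModule Y ⟶ (Scheme.Modules.pushforward f).obj (structureModule X) :=
  SheafOfModules.unitToPushforwardObjUnit f.toRingCatSheafHom

/-- `X` is Frobenius split: `𝒪_X ⟶ F_* 𝒪_X` has a left inverse in the category of
`𝒪_X`-modules. -/
def IsFrobeniusSplit (p : ℕ) [Fact p.Prime] (X : Scheme.{u}) (hX : HasCharacteristic p X) : Prop :=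
  ∃ φ : (Scheme.Modules.pushforward (frobenius p X hX)).obj (structureModule X) ⟶
      structureModule X,
    structureMap (frobenius p X hX) ≫ φ = 𝟙 (structureModule X)

/-- An invertible sheaf: an `𝒪_X`-module that is locally isomorphic to the structure sheaf. -/
def IsInvertibleSheaf {X : Scheme.{u}} (L : X.Modules) : Prop :=
  ∀ x : X, ∃ U : X.Opens, x ∈ U ∧ Nonempty (L.restrict U.ι ≅ structureModule (U : Scheme.{u}))

/-- The tensor product of two `𝒪_X`-modules: the sheaf associated to the presheaf
`U ↦ M(U) ⊗_{𝒪_X(U)} N(U)`. -/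
def tensor {X : Scheme.{u}} (M N : X.Modules) : X.Modules :=
  (PresheafOfModules.sheafification.{u} (𝟙 X.ringCatSheaf.obj)).obj
    (PresheafOfModules.Monoidal.tensorObj (R := X.presheaf) M.val N.val)

/-- The tensor powers `L^n` of an `𝒪_X`-module, for `n ≥ 0`. -/
def tensorPower {X : Scheme.{u}} (L : X.Modules) : ℕ → X.Modules
  | 0 => structureModule X
  | n + 1 => tensor (tensorPower L n) L

/-- The cohomology group `H^i(X, M)` of the sheaf of abelian groups underlying an
`𝒪_X`-module `M`. -/
abbrev cohomology {X : Scheme.{u}} (M : X.Modules) (i : ℕ) : Type u :=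
  Sheaf.H.{u} ((SheafOfModules.toSheaf X.ringCatSheaf).obj M) i

end FrobeniusSplitting

end

/-! Write `q = p ^ e`. On sections, a Frobenius splitting is an additive map `φ` with `φ (a ^ p * b)
= a * φ b` and `φ 1 = 1`; composing `e` copies gives such a `φ` for `q`.

Locally `L` is free on a section `t`, and `L^q` is free on `t^q`. There are two maps between `L` and
`F^e_* L^q`: `s ↦ s^q`, additive because `a ↦ a ^ q` is, and `a • t^q ↦ φ a • t`
(`PowerSplitting.contract`), independent of `t` because `φ (u ^ q * a) = u * φ a`. Since `φ (a ^ q)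
= a`, the second retracts the first (`PowerSplitting.nonempty_retract`), which is the second claim.

As `F^e` is the identity on the space, `F^e_* L^q` and `L^q` have the same underlying abelian sheaf
(`toSheafPushforwardIso`). So `H^i(L)` is a retract of `H^i(L^q)`, which vanishes for large `e`. -/

noncomputable section

namespace FrobeniusSplitting

/-! ### Restriction and gluing of sections. -/

variable {X : Scheme.{u}}

/-- Restriction of sections of an `𝒪_X`-module. -/
def res (M : X.Modules) {U V : X.Opens} (h : V ≤ U) : Γ(M, U) →+ Γ(M, V) :=
  (M.presheaf.map (homOfLE h).op).hom

/-- Restriction of functions. -/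
def funRes {U V : X.Opens} (h : V ≤ U) : Γ(X, U) →+* Γ(X, V) :=
  (X.presheaf.map (homOfLE h).op).hom

lemma funRes_self {U : X.Opens} (a : Γ(X, U)) : funRes le_rfl a = a := by
  change (X.presheaf.map (𝟙 _)).hom a = a
  rw [X.presheaf.map_id]
  rfl

lemma funRes_funRes {U V W : X.Opens} (h : V ≤ U) (k : W ≤ V) (a : Γ(X, U)) :
    funRes k (funRes h a) = funRes (k.trans h) a := by
  change (X.presheaf.map _ ≫ X.presheaf.map _).hom a = _
  rw [← X.presheaf.map_comp]
  rfl

section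

variable (M : X.Modules)

lemma res_self {U : X.Opens} (s : Γ(M, U)) : res M le_rfl s = s := by
  change (M.presheaf.map (𝟙 _)).hom s = s
  rw [M.presheaf.map_id]
  rfl

lemma res_res {U V W : X.Opens} (h : V ≤ U) (k : W ≤ V) (s : Γ(M, U)) :
    res M k (res M h s) = res M (k.trans h) s := by
  change (M.presheaf.map _ ≫ M.presheaf.map _).hom s = _
  rw [← M.presheaf.map_comp]
  rfl

lemma res_smul {U V : X.Opens} (h : V ≤ U) (a : Γ(X, U)) (s : Γ(M, U)) :
    res M h (a • s) = funRes h a • res M h s :=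
  Scheme.Modules.map_smul M (homOfLE h) a s

/-- Sections of an `𝒪_X`-module that agree locally are equal. -/
lemma section_ext {U : X.Opens} {s t : Γ(M, U)}
    (H : ∀ x ∈ U, ∃ (V : X.Opens) (h : V ≤ U), x ∈ V ∧ res M h s = res M h t) : s = t := by
  choose V hV hx e using H
  refine TopCat.Sheaf.eq_of_locally_eq' ⟨M.presheaf, M.isSheaf⟩ (fun x : U ↦ V x.1 x.2) U
    (fun x ↦ homOfLE (hV x.1 x.2)) ?_ s t fun x ↦ e x.1 x.2
  intro x hxU
  exact Opens.mem_iSup.2 ⟨⟨x, hxU⟩, hx x hxU⟩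

/-- Gluing of sections of an `𝒪_X`-module that are given locally by a relation. -/
lemma section_glue {U : X.Opens} (P : ∀ V : X.Opens, V ≤ U → Γ(M, V) → Prop)
    (hex : ∀ x ∈ U, ∃ (V : X.Opens) (h : V ≤ U) (s : Γ(M, V)), x ∈ V ∧ P V h s)
    (hcompat : ∀ (V W : X.Opens) (hV : V ≤ U) (hW : W ≤ U) (s : Γ(M, V)) (t : Γ(M, W)),
      P V hV s → P W hW t →
        res M (inf_le_left : V ⊓ W ≤ V) s = res M (inf_le_right : V ⊓ W ≤ W) t) :
    ∃ s : Γ(M, U), ∀ (V : X.Opens) (h : V ≤ U) (t : Γ(M, V)), P V h t → res M h s = t := by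
  choose V hV s hx hP using hex
  obtain ⟨r, hr, -⟩ := TopCat.Sheaf.existsUnique_gluing' ⟨M.presheaf, M.isSheaf⟩
    (fun x : U ↦ V x.1 x.2) U (fun x ↦ homOfLE (hV x.1 x.2))
    (fun x hxU ↦ Opens.mem_iSup.2 ⟨⟨x, hxU⟩, hx x hxU⟩) (fun x ↦ s x.1 x.2)
    (fun x y ↦ hcompat _ _ _ _ _ _ (hP x.1 x.2) (hP y.1 y.2))
  -- The glued section restricts to every `t` satisfying `P`, not only to the chosen ones, since `t`
  -- is compatible with those.
  refine ⟨r, fun W h t ht ↦ section_ext M fun x hxW ↦ ⟨V x (h hxW) ⊓ W, inf_le_right,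
    ⟨hx _ _, hxW⟩, ?_⟩⟩
  have e : res M (hV x (h hxW)) r = s x (h hxW) := hr ⟨x, h hxW⟩
  rw [← hcompat _ _ _ _ _ _ (hP x (h hxW)) ht, ← e, res_res, res_res]

end

lemma fun_ext {U : X.Opens} {s t : Γ(X, U)}
    (H : ∀ x ∈ U, ∃ (V : X.Opens) (h : V ≤ U), x ∈ V ∧ funRes h s = funRes h t) : s = t :=
  section_ext (structureModule X) H

/-- Gluing of functions that are given locally by a relation. -/
lemma fun_glue {U : X.Opens} (P : ∀ V : X.Opens, V ≤ U → Γ(X, V) → Prop)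
    (hex : ∀ x ∈ U, ∃ (V : X.Opens) (h : V ≤ U) (s : Γ(X, V)), x ∈ V ∧ P V h s)
    (hcompat : ∀ (V W : X.Opens) (hV : V ≤ U) (hW : W ≤ U) (s : Γ(X, V)) (t : Γ(X, W)),
      P V hV s → P W hW t →
        funRes (inf_le_left : V ⊓ W ≤ V) s = funRes (inf_le_right : V ⊓ W ≤ W) t) :
    ∃ s : Γ(X, U), ∀ (V : X.Opens) (h : V ≤ U) (t : Γ(X, V)), P V h t → funRes h s = t :=
  section_glue (structureModule X) P hex hcompat

/-! ### Local generators of invertible sheaves. -/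

/-- A section that freely generates the module `M` on `V`. -/
def IsGenerator (M : X.Modules) {V : X.Opens} (g : Γ(M, V)) : Prop :=
  ∀ (W : X.Opens) (h : W ≤ V), Function.Bijective fun a : Γ(X, W) ↦ a • res M h g

lemma IsGenerator.res {M : X.Modules} {V W : X.Opens} {g : Γ(M, V)} (hg : IsGenerator M g)
    (h : W ≤ V) : IsGenerator M (res M h g) := fun W' h' ↦ by
  simpa only [res_res] using hg W' (h'.trans h)

lemma IsGenerator.smul_injective {M : X.Modules} {V : X.Opens} {g : Γ(M, V)}
    (hg : IsGenerator M g) {a b : Γ(X, V)} (e : a • g = b • g) : a = b :=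
  (hg V le_rfl).1 (by simpa only [res_self] using e)

lemma IsGenerator.exists_eq_smul {M : X.Modules} {V : X.Opens} {g : Γ(M, V)}
    (hg : IsGenerator M g) (s : Γ(M, V)) : ∃ a : Γ(X, V), s = a • g := by
  obtain ⟨a, ha⟩ := (hg V le_rfl).2 s
  exact ⟨a, by simpa only [res_self] using ha.symm⟩

/-- A section which is free and locally generating is a generator. -/
lemma isGenerator_of_locally {M : X.Modules} {V : X.Opens} {g : Γ(M, V)}
    (hinj : ∀ (W : X.Opens) (h : W ≤ V) (a b : Γ(X, W)), a • res M h g = b • res M h g → a = b)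
    (hsurj : ∀ (W : X.Opens) (h : W ≤ V) (s : Γ(M, W)), ∀ x ∈ W, ∃ (W' : X.Opens) (h' : W' ≤ W),
      x ∈ W' ∧ ∃ a : Γ(X, W'), res M h' s = a • res M (h'.trans h) g) :
    IsGenerator M g := fun W h ↦ by
  refine ⟨hinj W h, fun s ↦ ?_⟩
  -- The local coefficients of `s` are unique by `hinj`, hence glue.
  obtain ⟨a, ha⟩ := fun_glue (U := W)
    (fun W' h' (a : Γ(X, W')) ↦ res M h' s = a • res M (h'.trans h) g) (fun x hx ↦ by
      obtain ⟨W', h', hx', a, ha⟩ := hsurj W h s x hx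
      exact ⟨W', h', a, hx', ha⟩) (fun V₁ V₂ h₁ h₂ a b ha hb ↦ by
      refine hinj _ (inf_le_left.trans (h₁.trans h)) _ _ ?_
      have e₁ := congrArg (res M (inf_le_left : V₁ ⊓ V₂ ≤ V₁)) ha
      have e₂ := congrArg (res M (inf_le_right : V₁ ⊓ V₂ ≤ V₂)) hb
      rw [res_smul, res_res, res_res] at e₁ e₂
      exact e₁.symm.trans e₂)
  refine ⟨a, section_ext M fun x hx ↦ ?_⟩
  obtain ⟨W', h', hx', b, hb⟩ := hsurj W h s x hx
  refine ⟨W', h', hx', ?_⟩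
  change res M h' (a • res M h g) = _
  rw [res_smul, ha W' h' b hb, hb, res_res]

/-- An isomorphism `L|_U ≅ 𝒪_U` gives a generator on `U`. -/
lemma IsInvertibleSheaf.exists_isGenerator {L : X.Modules} (hL : IsInvertibleSheaf L) (x : X) :
    ∃ (V : X.Opens) (t : Γ(L, V)), x ∈ V ∧ IsGenerator L t := by
  obtain ⟨U, hxU, ⟨e⟩⟩ := hL x
  let t : Γ(L, U.ι ''ᵁ ⊤) := e.inv.app ⊤ (1 : Γ(U, ⊤))
  have hU : U.ι ''ᵁ ⊤ = U := by simp
  refine ⟨U.ι ''ᵁ ⊤, t, by rwa [hU], fun W h ↦ ?_⟩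
  obtain ⟨W', rfl⟩ : ∃ W' : (U : Scheme.{u}).Opens, W = U.ι ''ᵁ W' := by
    refine ⟨U.ι ⁻¹ᵁ W, ?_⟩
    rw [Scheme.Hom.image_preimage_eq_opensRange_inf]
    simpa using h.trans hU.le
  have hone : e.inv.app W' (1 : Γ(U, W')) = res L h t := by
    have hn := ConcreteCategory.congr_hom
      (e.inv.mapPresheaf.naturality (homOfLE le_top : W' ⟶ ⊤).op) (1 : Γ(U, ⊤))
    have h1 : (structureModule (U : Scheme.{u})).presheaf.map (homOfLE le_top : W' ⟶ ⊤).op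
        (1 : Γ(U, ⊤)) = (1 : Γ(U, W')) :=
      map_one ((U : Scheme.{u}).presheaf.map (homOfLE le_top : W' ⟶ ⊤).op).hom
    change e.inv.app W' ((structureModule (U : Scheme.{u})).presheaf.map _ _) = _ at hn
    rw [h1] at hn
    exact hn
  have hmap : ∀ a : Γ(U, W'), e.inv.app W' a =
      ((U.ι.appIso W').inv.hom a • res L h t : Γ(L, U.ι ''ᵁ W')) := fun a ↦ by
    have h1 : (a • (1 : Γ(U, W')) : Γ(structureModule (U : Scheme.{u}), W')) = a := mul_one a
    have ha := (congrArg (e.inv.app W') h1).symm.trans (e.inv.app_smul a (1 : Γ(U, W')))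
    rw [hone] at ha
    exact ha
  have hb : Function.Bijective (e.inv.app W') := ConcreteCategory.bijective_of_isIso _
  have hc : Function.Bijective (U.ι.appIso W').hom := ConcreteCategory.bijective_of_isIso _
  -- Multiplication by `t` is the identification of functions on the image of `W'` with those on
  -- `W'`, followed by `e.inv`; both are bijective.
  have key : (fun a : Γ(X, U.ι ''ᵁ W') ↦ a • res L h t) =
      fun a ↦ e.inv.app W' ((U.ι.appIso W').hom a) := by
    funext a
    refine Eq.trans ?_ (hmap _).symm
    exact congrArg (fun b : Γ(X, U.ι ''ᵁ W') ↦ b • res L h t)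
      (ConcreteCategory.congr_hom (U.ι.appIso W').hom_inv_id a).symm
  rw [key]
  exact hb.comp hc

/-! ### Tensor products and tensor powers of sections. -/

section

-- Both modules are free of rank one, so their tensor product is `R ⊗ R ≅ R`.
open scoped TensorProduct in
lemma bijective_smul_tmul {R M N : Type*} [CommRing R] [AddCommGroup M] [AddCommGroup N]
    [Module R M] [Module R N] {m : M} {n : N} (hm : Function.Bijective fun a : R ↦ a • m)
    (hn : Function.Bijective fun a : R ↦ a • n) :
    Function.Bijective fun a : R ↦ a • (m ⊗ₜ[R] n) := by
  let em := LinearEquiv.ofBijective (LinearMap.toSpanSingleton R M m) hm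
  let en := LinearEquiv.ofBijective (LinearMap.toSpanSingleton R N n) hn
  convert ((TensorProduct.lid R R).symm ≪≫ₗ TensorProduct.congr em en).bijective using 2 with a
  change a • (m ⊗ₜ[R] n) = ((1 : R) • m) ⊗ₜ[R] (a • n)
  rw [one_smul, TensorProduct.tmul_smul]

variable (M N : X.Modules)

/-- The presheaf tensor product of two `𝒪_X`-modules. -/
def presheafTensor : X.PresheafOfModules :=
  PresheafOfModules.Monoidal.tensorObj (R := X.presheaf) M.val N.val

/-- The map from the presheaf tensor product to the tensor product. -/
def tensorUnit : presheafTensor M N ⟶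
    (PresheafOfModules.restrictScalars (𝟙 X.ringCatSheaf.obj)).obj (tensor M N).val :=
  (PresheafOfModules.sheafificationAdjunction (𝟙 X.ringCatSheaf.obj)).unit.app
    (presheafTensor M N)

lemma toPresheaf_map_tensorUnit :
    (PresheafOfModules.toPresheaf _).map (tensorUnit M N) =
      CategoryTheory.toSheafify (Opens.grothendieckTopology X) (presheafTensor M N).presheaf :=
  PresheafOfModules.toPresheaf_map_sheafificationAdjunction_unit_app _ _

open scoped TensorProduct

/-- The canonical map from the tensor product of sections to the sections of the tensor
product. -/
def toTensor (U : X.Opens) : Γ(M, U) ⊗[Γ(X, U)] Γ(N, U) →ₗ[Γ(X, U)] Γ(tensor M N, U) where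
  toFun z := ((tensorUnit M N).app (.op U)).hom z
  map_add' := ((tensorUnit M N).app (.op U)).hom.map_add
  map_smul' := ((tensorUnit M N).app (.op U)).hom.map_smul

/-- Restriction on the presheaf tensor product. -/
def tensorRes {U V : X.Opens} (h : V ≤ U) :
    Γ(M, U) ⊗[Γ(X, U)] Γ(N, U) →+ Γ(M, V) ⊗[Γ(X, V)] Γ(N, V) :=
  ((presheafTensor M N).presheaf.map (homOfLE h).op).hom

lemma res_toTensor {U V : X.Opens} (h : V ≤ U) (z : Γ(M, U) ⊗[Γ(X, U)] Γ(N, U)) :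
    res (tensor M N) h (toTensor M N U z) = toTensor M N V (tensorRes M N h z) :=
  (ConcreteCategory.congr_hom (((PresheafOfModules.toPresheaf _).map
    (tensorUnit M N)).naturality (homOfLE h).op) z).symm

/-- The unit of sheafification is locally surjective, and locally injective for the next lemma. -/
lemma exists_toTensor_eq {U : X.Opens} (s : Γ(tensor M N, U)) (x : X) (hx : x ∈ U) :
    ∃ (V : X.Opens) (h : V ≤ U), x ∈ V ∧ ∃ z, toTensor M N V z = res (tensor M N) h s := by
  have hs : Presheaf.IsLocallySurjective (Opens.grothendieckTopology X)
    ((PresheafOfModules.toPresheaf _).map (tensorUnit M N)) := by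
    rw [toPresheaf_map_tensorUnit]
    exact (GrothendieckTopology.W_toSheafify _ _).isLocallySurjective
  obtain ⟨V, f, ⟨z, hz⟩, hV⟩ := hs.imageSieve_mem (U := U) s x hx
  exact ⟨V, f.le, hV, z, hz⟩

lemma exists_tensorRes_eq {U : X.Opens} {z w : Γ(M, U) ⊗[Γ(X, U)] Γ(N, U)}
    (e : toTensor M N U z = toTensor M N U w) (x : X) (hx : x ∈ U) :
    ∃ (V : X.Opens) (h : V ≤ U), x ∈ V ∧ tensorRes M N h z = tensorRes M N h w := by
  have hs : Presheaf.IsLocallyInjective (Opens.grothendieckTopology X)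
    ((PresheafOfModules.toPresheaf _).map (tensorUnit M N)) := by
    rw [toPresheaf_map_tensorUnit]
    exact (GrothendieckTopology.W_toSheafify _ _).isLocallyInjective
  obtain ⟨V, f, hf, hV⟩ := hs.equalizerSieve_mem (X := .op U) z w e x hx
  exact ⟨V, f.le, hV, hf⟩

variable {M N}

/-- The tensor product of two sections. -/
def tmul {U : X.Opens} (m : Γ(M, U)) (n : Γ(N, U)) : Γ(tensor M N, U) :=
  toTensor M N U (m ⊗ₜ n)

lemma tensorRes_tmul {U V : X.Opens} (h : V ≤ U) (m : Γ(M, U)) (n : Γ(N, U)) :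
    tensorRes M N h (m ⊗ₜ n) = res M h m ⊗ₜ res N h n :=
  rfl

lemma tensorRes_smul {U V : X.Opens} (h : V ≤ U) (a : Γ(X, U))
    (z : Γ(M, U) ⊗[Γ(X, U)] Γ(N, U)) :
    tensorRes M N h (a • z) = funRes h a • tensorRes M N h z :=
  (presheafTensor M N).map_smul _ a z

lemma res_tmul {U V : X.Opens} (h : V ≤ U) (m : Γ(M, U)) (n : Γ(N, U)) :
    res (tensor M N) h (tmul m n) = tmul (res M h m) (res N h n) := by
  rw [tmul, res_toTensor, tensorRes_tmul, tmul]

lemma tmul_smul_smul {U : X.Opens} (a b : Γ(X, U)) (m : Γ(M, U)) (n : Γ(N, U)) :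
    tmul (a • m) (b • n) = (a * b) • tmul m n := by
  rw [tmul, tmul, ← map_smul, TensorProduct.smul_tmul_smul]

/-- Freeness holds in the presheaf tensor product over each open set and passes through
sheafification because it is a local property. -/
lemma IsGenerator.tmul {V : X.Opens} {m : Γ(M, V)} {n : Γ(N, V)} (hm : IsGenerator M m)
    (hn : IsGenerator N n) : IsGenerator (tensor M N) (tmul m n) := by
  have key := fun (W : X.Opens) (h : W ≤ V) ↦ bijective_smul_tmul (hm W h) (hn W h)
  refine isGenerator_of_locally (fun W h a b e ↦ ?_) fun W h s x hx ↦ ?_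
  · rw [res_tmul, FrobeniusSplitting.tmul, ← map_smul, ← map_smul] at e
    refine fun_ext fun x hx ↦ ?_
    obtain ⟨W', h', hx', e'⟩ := exists_tensorRes_eq M N e x hx
    refine ⟨W', h', hx', (key W' (h'.trans h)).1 ?_⟩
    rwa [tensorRes_smul, tensorRes_smul, tensorRes_tmul, res_res, res_res] at e'
  · obtain ⟨W', h', hx', z, hz⟩ := exists_toTensor_eq M N s x hx
    obtain ⟨a, rfl⟩ := (key W' (h'.trans h)).2 z
    exact ⟨W', h', hx', a, by rw [← hz, map_smul, res_tmul, FrobeniusSplitting.tmul]⟩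

/-- The tensor power of a section. -/
def tensorPow {L : X.Modules} {U : X.Opens} (s : Γ(L, U)) : ∀ n : ℕ, Γ(tensorPower L n, U)
  | 0 => (1 : Γ(X, U))
  | n + 1 => tmul (tensorPow s n) s

variable {L : X.Modules}

lemma res_tensorPow {U V : X.Opens} (h : V ≤ U) (s : Γ(L, U)) (n : ℕ) :
    res _ h (tensorPow s n) = tensorPow (res L h s) n := by
  induction n with
  | zero => exact map_one (funRes h)
  | succ n ih => exact (res_tmul h _ _).trans (by rw [ih, tensorPow])

lemma tensorPow_smul {U : X.Opens} (a : Γ(X, U)) (s : Γ(L, U)) (n : ℕ) :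
    tensorPow (a • s) n = a ^ n • tensorPow s n := by
  induction n with
  | zero =>
    rw [pow_zero, one_smul]
    rfl
  | succ n ih =>
    rw [tensorPow, ih, pow_succ]
    exact tmul_smul_smul _ _ _ _

lemma IsGenerator.tensorPow {V : X.Opens} {t : Γ(L, V)} (ht : IsGenerator L t) (n : ℕ) :
    IsGenerator (tensorPower L n) (tensorPow t n) := by
  induction n with
  | zero =>
    intro W h
    have key : (fun a : Γ(X, W) ↦ a * funRes h (1 : Γ(X, V))) = id := by
      funext a
      rw [map_one, mul_one, id]
    change Function.Bijective fun a : Γ(X, W) ↦ a * funRes h (1 : Γ(X, V))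
    rw [key]
    exact Function.bijective_id
  | succ n ih => exact ih.tmul ht

end

/-! ### Splittings of power maps on functions. -/

/-- A splitting of the `q`-th power map of the structure sheaf: a natural family of additive maps
on sections with `φ (a ^ q * b) = a * φ b` and `φ 1 = 1`. -/
structure PowerSplitting (q : ℕ) (X : Scheme.{u}) where
  /-- the map on sections -/
  app (U : X.Opens) : Γ(X, U) →+ Γ(X, U)
  res_app {U V : X.Opens} (h : V ≤ U) (a : Γ(X, U)) : funRes h (app U a) = app V (funRes h a)
  app_pow_mul {U : X.Opens} (a b : Γ(X, U)) : app U (a ^ q * b) = a * app U b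
  app_one (U : X.Opens) : app U 1 = 1

lemma PowerSplitting.app_pow {q : ℕ} (φ : PowerSplitting q X) {U : X.Opens} (a : Γ(X, U)) :
    φ.app U (a ^ q) = a := by
  rw [← mul_one (a ^ q), φ.app_pow_mul, φ.app_one, mul_one]

/-- The composition of two splittings of power maps. -/
def PowerSplitting.comp {q r : ℕ} (φ : PowerSplitting q X) (ψ : PowerSplitting r X) :
    PowerSplitting (q * r) X where
  app U := (φ.app U).comp (ψ.app U)
  res_app h a := by simp [φ.res_app, ψ.res_app]
  app_pow_mul a b := by simp [pow_mul, ψ.app_pow_mul, φ.app_pow_mul]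
  app_one U := by simp [φ.app_one, ψ.app_one]

/-- The trivial splitting. -/
def PowerSplitting.refl : PowerSplitting 1 X where
  app _ := AddMonoidHom.id _
  res_app _ _ := rfl
  app_pow_mul a b := by simp
  app_one _ := rfl

/-- Functions act on `F_* 𝒪_X` through `p`-th powers, so linearity of the splitting is exactly
`app_pow_mul`. -/
lemma IsFrobeniusSplit.nonempty_powerSplitting {p : ℕ} [Fact p.Prime] {hX : HasCharacteristic p X}
    (h : IsFrobeniusSplit p X hX) : Nonempty (PowerSplitting p X) := by
  obtain ⟨φ, hφ⟩ := h
  refine ⟨{ app U := (φ.app U).hom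
            res_app {U V} h a := ?_
            app_pow_mul {U} a b := φ.app_smul (U := U) a b
            app_one U := ?_ }⟩
  · exact (ConcreteCategory.congr_hom (φ.mapPresheaf.naturality (homOfLE h).op) a).symm
  · have h₁ := congrArg (fun ψ : structureModule X ⟶ structureModule X ↦
      ψ.app U (1 : Γ(X, U))) hφ
    refine Eq.trans ?_ h₁
    exact congrArg (φ.app U) (one_pow (M := Γ(X, U)) p).symm

lemma PowerSplitting.nonempty_pow {p : ℕ} (φ : PowerSplitting p X) (e : ℕ) :
    Nonempty (PowerSplitting (p ^ e) X) := by
  induction e with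
  | zero => exact ⟨.refl⟩
  | succ e ih => exact ⟨pow_succ p e ▸ ih.some.comp φ⟩

lemma HasCharacteristic.add_pow_pow {p : ℕ} [Fact p.Prime] (hX : HasCharacteristic p X) (e : ℕ)
    {U : X.Opens} (a b : Γ(X, U)) : (a + b) ^ p ^ e = a ^ p ^ e + b ^ p ^ e := by
  induction e with
  | zero => simp
  | succ e ih =>
    simp only [pow_succ p, pow_mul, ih]
    exact map_add (powerHom p Γ(X, U) (hX.cast_eq_zero U)) _ _

/-! ### The contraction from `L^q` to `L`. -/

variable {L : X.Modules} {q : ℕ}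

lemma IsInvertibleSheaf.exists_isGenerator_le (hL : IsInvertibleSheaf L) {U : X.Opens} {x : X}
    (hx : x ∈ U) : ∃ (V : X.Opens) (_ : V ≤ U) (t : Γ(L, V)), x ∈ V ∧ IsGenerator L t := by
  obtain ⟨V, t, hxV, ht⟩ := hL.exists_isGenerator x
  exact ⟨V ⊓ U, inf_le_right, res L inf_le_left t, ⟨hxV, hx⟩, ht.res _⟩

/-- On sections of an invertible sheaf, the `q`-th tensor power is additive if the `q`-th power
of functions is. -/
lemma tensorPow_add (hL : IsInvertibleSheaf L)
    (hq : ∀ (U : X.Opens) (a b : Γ(X, U)), (a + b) ^ q = a ^ q + b ^ q) {U : X.Opens}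
    (s t : Γ(L, U)) : tensorPow (s + t) q = tensorPow s q + tensorPow t q := by
  refine section_ext _ fun x hx ↦ ?_
  obtain ⟨V, h, g, hxV, hg⟩ := hL.exists_isGenerator_le hx
  refine ⟨V, h, hxV, ?_⟩
  obtain ⟨a, ha⟩ := hg.exists_eq_smul (res L h s)
  obtain ⟨b, hb⟩ := hg.exists_eq_smul (res L h t)
  rw [map_add, res_tensorPow, res_tensorPow, res_tensorPow, map_add, ha, hb, ← add_smul,
    tensorPow_smul, tensorPow_smul, tensorPow_smul, hq, add_smul]

namespace PowerSplitting

variable (φ : PowerSplitting q X)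

lemma exists_contract (hL : IsInvertibleSheaf L) {U : X.Opens} (s : Γ(tensorPower L q, U)) :
    ∃ r : Γ(L, U), ∀ (V : X.Opens) (h : V ≤ U) (t : Γ(L, V)), IsGenerator L t →
      ∀ a : Γ(X, V), res _ h s = a • tensorPow t q → res L h r = φ.app V a • t := by
  obtain ⟨r, hr⟩ := section_glue L (fun V h r ↦ ∃ t : Γ(L, V), IsGenerator L t ∧
      ∃ a : Γ(X, V), res _ h s = a • tensorPow t q ∧ r = φ.app V a • t) (fun x hx ↦ by
    obtain ⟨V, h, t, hxV, ht⟩ := hL.exists_isGenerator_le hx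
    obtain ⟨a, ha⟩ := (ht.tensorPow q).exists_eq_smul (res _ h s)
    exact ⟨V, h, _, hxV, t, ht, a, ha, rfl⟩) (by
    rintro V W hV hW _ _ ⟨t, ht, a, ha, rfl⟩ ⟨t', -, a', ha', rfl⟩
    have ht₁ := ht.res (inf_le_left : V ⊓ W ≤ V)
    -- With `t' = u • t` on the overlap, comparing coefficients of `t^q` gives `a = u ^ q * a'`,
    -- hence `φ a = u * φ a'`.
    obtain ⟨u, hu⟩ := ht₁.exists_eq_smul (FrobeniusSplitting.res L inf_le_right t')
    have e := congrArg (FrobeniusSplitting.res _ (inf_le_left : V ⊓ W ≤ V)) ha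
    have e' := congrArg (FrobeniusSplitting.res _ (inf_le_right : V ⊓ W ≤ W)) ha'
    rw [res_res, res_smul, res_tensorPow] at e e'
    rw [hu, tensorPow_smul, smul_smul, e, mul_comm] at e'
    rw [res_smul, res_smul, φ.res_app, φ.res_app, (ht₁.tensorPow q).smul_injective e',
      φ.app_pow_mul, hu, smul_smul, mul_comm])
  exact ⟨r, fun V h t ht a ha ↦ hr V h _ ⟨t, ht, a, ha, rfl⟩⟩

/-- The map `L^q → L` on sections that sends `a • t ^ q` to `φ a • t` for local generators `t`
of `L`. -/
def contract (hL : IsInvertibleSheaf L) {U : X.Opens} (s : Γ(tensorPower L q, U)) : Γ(L, U) :=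
  (φ.exists_contract hL s).choose

variable (hL : IsInvertibleSheaf L)

lemma res_contract_eq {U V : X.Opens} (s : Γ(tensorPower L q, U)) (h : V ≤ U) {t : Γ(L, V)}
    (ht : IsGenerator L t) {a : Γ(X, V)} (ha : res _ h s = a • tensorPow t q) :
    res L h (φ.contract hL s) = φ.app V a • t :=
  (φ.exists_contract hL s).choose_spec V h t ht a ha

lemma contract_smul_tensorPow {V : X.Opens} {t : Γ(L, V)} (ht : IsGenerator L t) (a : Γ(X, V)) :
    φ.contract hL (a • tensorPow t q) = φ.app V a • t := by
  have := φ.res_contract_eq hL (a • tensorPow t q) le_rfl ht (a := a) (res_self _ _)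
  rwa [res_self] at this

lemma res_contract {U V : X.Opens} (h : V ≤ U) (s : Γ(tensorPower L q, U)) :
    res L h (φ.contract hL s) = φ.contract hL (res _ h s) := by
  refine section_ext _ fun x hx ↦ ?_
  obtain ⟨W, k, t, hxW, ht⟩ := hL.exists_isGenerator_le hx
  obtain ⟨a, ha⟩ := (ht.tensorPow q).exists_eq_smul (res _ (k.trans h) s)
  refine ⟨W, k, hxW, ?_⟩
  rw [res_res, φ.res_contract_eq hL s _ ht ha,
    φ.res_contract_eq hL _ k ht (a := a) (by rw [res_res, ha])]

lemma contract_add {U : X.Opens} (s t : Γ(tensorPower L q, U)) :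
    φ.contract hL (s + t) = φ.contract hL s + φ.contract hL t := by
  refine section_ext _ fun x hx ↦ ?_
  obtain ⟨V, h, g, hxV, hg⟩ := hL.exists_isGenerator_le hx
  refine ⟨V, h, hxV, ?_⟩
  obtain ⟨a, ha⟩ := (hg.tensorPow q).exists_eq_smul (res _ h s)
  obtain ⟨b, hb⟩ := (hg.tensorPow q).exists_eq_smul (res _ h t)
  simp only [map_add, res_contract, ha, hb, ← add_smul, contract_smul_tensorPow _ _ hg]

lemma contract_pow_smul {U : X.Opens} (a : Γ(X, U)) (s : Γ(tensorPower L q, U)) :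
    φ.contract hL (a ^ q • s) = a • φ.contract hL s := by
  refine section_ext _ fun x hx ↦ ?_
  obtain ⟨V, h, g, hxV, hg⟩ := hL.exists_isGenerator_le hx
  refine ⟨V, h, hxV, ?_⟩
  obtain ⟨b, hb⟩ := (hg.tensorPow q).exists_eq_smul (res _ h s)
  simp only [res_smul, res_contract, hb, smul_smul, contract_smul_tensorPow _ _ hg, map_pow,
    φ.app_pow_mul]

lemma contract_tensorPow {U : X.Opens} (s : Γ(L, U)) : φ.contract hL (tensorPow s q) = s := by
  refine section_ext _ fun x hx ↦ ?_
  obtain ⟨V, h, g, hxV, hg⟩ := hL.exists_isGenerator_le hx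
  refine ⟨V, h, hxV, ?_⟩
  obtain ⟨b, hb⟩ := hg.exists_eq_smul (res _ h s)
  rw [res_contract, res_tensorPow, hb, tensorPow_smul, contract_smul_tensorPow _ _ hg, φ.app_pow]

end PowerSplitting

/-! ### The direct summand. -/

/-- A morphism of `𝒪_X`-modules from its maps on sections. -/
def homOfSections {M N : X.Modules} (f : ∀ U : X.Opens, Γ(M, U) →+ Γ(N, U))
    (hres : ∀ {U V : X.Opens} (h : V ≤ U) (s : Γ(M, U)), res N h (f U s) = f V (res M h s))
    (hsmul : ∀ (U : X.Opens) (a : Γ(X, U)) (s : Γ(M, U)), f U (a • s) = a • f U s) : M ⟶ N :=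
  SheafOfModules.Hom.mk (PresheafOfModules.homMk
    { app U := AddCommGrpCat.ofHom (f U.unop)
      naturality U V i := by
        ext s
        exact (hres i.unop.le s).symm }
    fun U a s ↦ hsmul U.unop a s)

/-- If `f` is a topological identity and the `q`-th power map on functions, then an invertible
sheaf `L` is a direct summand of `f_* L^q`. -/
lemma PowerSplitting.nonempty_retract {q : ℕ} (φ : PowerSplitting q X)
    (hq : ∀ (U : X.Opens) (a b : Γ(X, U)), (a + b) ^ q = a ^ q + b ^ q)
    {f : X ⟶ X} (hf : ∀ U : X.Opens, f ⁻¹ᵁ U = U)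
    (happ : ∀ (U : X.Opens) (a : Γ(X, U)), f.app U a = funRes (hf U).le (a ^ q))
    {L : X.Modules} (hL : IsInvertibleSheaf L) :
    Nonempty (Retract L ((Scheme.Modules.pushforward f).obj (tensorPower L q))) := by
  let i : L ⟶ (Scheme.Modules.pushforward f).obj (tensorPower L q) := homOfSections
    (fun U ↦ (res (tensorPower L q) (hf U).le).comp
      (AddMonoidHom.mk' (fun s ↦ tensorPow s q) (tensorPow_add hL hq)))
    (fun {U V} h s ↦ by
      change res (tensorPower L q) (f.preimage_mono h) (res _ (hf U).le (tensorPow s q)) =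
        res _ (hf V).le (tensorPow (res L h s) q)
      rw [← res_tensorPow, res_res, res_res])
    (fun U a s ↦ by
      change res _ (hf U).le (tensorPow (a • s) q) =
        f.app U a • res (tensorPower L q) (hf U).le (tensorPow s q)
      rw [tensorPow_smul, res_smul, happ])
  let r : (Scheme.Modules.pushforward f).obj (tensorPower L q) ⟶ L := homOfSections
    (fun U ↦ (AddMonoidHom.mk' (φ.contract hL) (φ.contract_add hL)).comp
      (res (tensorPower L q) (hf U).ge))
    (fun {U V} h (s : Γ(tensorPower L q, f ⁻¹ᵁ U)) ↦ by
      change res L h (φ.contract hL (res (tensorPower L q) (hf U).ge s)) =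
        φ.contract hL (res _ (hf V).ge (res (tensorPower L q) (f.preimage_mono h) s))
      rw [φ.res_contract, res_res, res_res])
    (fun U a (s : Γ(tensorPower L q, f ⁻¹ᵁ U)) ↦ by
      change φ.contract hL (res (tensorPower L q) (hf U).ge (f.app U a • s)) =
        a • φ.contract hL (res (tensorPower L q) (hf U).ge s)
      rw [res_smul, happ, funRes_funRes, funRes_self, φ.contract_pow_smul])
  refine ⟨⟨i, r, Scheme.Modules.hom_ext _ _ fun U ↦ ?_⟩⟩
  ext s
  change φ.contract hL (res (tensorPower L q) (hf U).ge (res _ (hf U).le (tensorPow s q))) = s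
  rw [res_res, res_self, φ.contract_tensorPow]

/-! ### Frobenius iterates and cohomology. -/

section

variable (p : ℕ) [Fact p.Prime] (hX : HasCharacteristic p X)

lemma frobeniusIter_preimage (e : ℕ) (U : X.Opens) : frobeniusIter p X hX e ⁻¹ᵁ U = U := by
  induction e with
  | zero => rfl
  | succ e ih => exact ih

lemma frobeniusIter_app (e : ℕ) (U : X.Opens) (a : Γ(X, U)) :
    (frobeniusIter p X hX e).app U a =
      funRes (frobeniusIter_preimage p hX e U).le (a ^ p ^ e) := by
  induction e generalizing a with
  | zero =>
    rw [pow_zero, pow_one]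
    exact (funRes_self a).symm
  | succ e ih =>
    -- On functions the last factor of the composite acts first: `a` goes to `a ^ p`, then the
    -- `e`-th iterate applies.
    rw [pow_succ', pow_mul]
    exact ih (a ^ p)

end

/-- The sheaf of abelian groups underlying `f_* M` is that of `M` if `f` is a topological
identity. -/
def toSheafPushforwardIso {f : X ⟶ X} (hf : ∀ U : X.Opens, f ⁻¹ᵁ U = U) (M : X.Modules) :
    (SheafOfModules.toSheaf X.ringCatSheaf).obj ((Scheme.Modules.pushforward f).obj M) ≅
      (SheafOfModules.toSheaf X.ringCatSheaf).obj M where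
  hom := ⟨{ app U := AddCommGrpCat.ofHom (res M (hf U.unop).ge)
            naturality U V i := by
              ext (s : Γ(M, f ⁻¹ᵁ U.unop))
              exact (res_res M (f.preimage_mono i.unop.le) (hf V.unop).ge s).trans
                (res_res M (hf U.unop).ge i.unop.le s).symm }⟩
  inv := ⟨{ app U := AddCommGrpCat.ofHom (res M (hf U.unop).le)
            naturality U V i := by
              ext (s : Γ(M, U.unop))
              exact (res_res M i.unop.le (hf V.unop).le s).trans
                (res_res M (hf U.unop).le (f.preimage_mono i.unop.le) s).symm }⟩
  hom_inv_id := by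
    ext U (s : Γ(M, f ⁻¹ᵁ U.unop))
    exact (res_res M (hf U.unop).ge (hf U.unop).le s).trans (res_self M s)
  inv_hom_id := by
    ext U (s : Γ(M, U.unop))
    exact (res_res M (hf U.unop).le (hf U.unop).ge s).trans (res_self M s)

/-- Cohomology is functorial, so it preserves retracts. -/
lemma subsingleton_H_of_retract {C : Type*} [Category* C] {J : GrothendieckTopology C}
    [HasSheafify J AddCommGrpCat.{u}] [HasExt.{u} (Sheaf J AddCommGrpCat.{u})]
    {F G : Sheaf J AddCommGrpCat.{u}} (h : Retract F G) (n : ℕ) [Subsingleton (Sheaf.H.{u} G n)] :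
    Subsingleton (Sheaf.H.{u} F n) := by
  refine Function.Injective.subsingleton (f := Sheaf.H.map h.i n)
    (Function.LeftInverse.injective (g := Sheaf.H.map h.r n) fun x ↦ ?_)
  rw [← Sheaf.H.map_comp_apply, h.retract, Sheaf.H.map_id_apply]

end FrobeniusSplitting

end

open FrobeniusSplitting in
theorem mainTheorem5 (p : ℕ) [Fact p.Prime] (X : Scheme.{u}) (hX : HasCharacteristic p X)
    (hsplit : IsFrobeniusSplit p X hX) (L : X.Modules) (hL : IsInvertibleSheaf L) :
    (∀ i : ℕ, (∃ N : ℕ, ∀ n ≥ N, Subsingleton (cohomology (tensorPower L n) i)) →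
      Subsingleton (cohomology L i)) ∧
    (∀ e : ℕ, Nonempty (Retract L ((Scheme.Modules.pushforward (frobeniusIter p X hX e)).obj
      (tensorPower L (p ^ e))))) := by
  have hretract (e : ℕ) : Nonempty (Retract L
      ((Scheme.Modules.pushforward (frobeniusIter p X hX e)).obj (tensorPower L (p ^ e)))) := by
    obtain ⟨φ⟩ := hsplit.nonempty_powerSplitting
    obtain ⟨φ⟩ := φ.nonempty_pow e
    exact φ.nonempty_retract (fun U ↦ hX.add_pow_pow e) (frobeniusIter_preimage p hX e)
      (frobeniusIter_app p hX e) hL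
  refine ⟨fun i ⟨N, hN⟩ ↦ ?_, hretract⟩
  -- The exponent `e = N` is large enough, because `N < p ^ N`.
  obtain ⟨ρ⟩ := hretract N
  have : Subsingleton (cohomology (tensorPower L (p ^ N)) i) :=
    hN _ (Nat.lt_pow_self (Fact.out : p.Prime).one_lt).le
  exact subsingleton_H_of_retract ((ρ.map (SheafOfModules.toSheaf X.ringCatSheaf)).trans
    (.ofIso (toSheafPushforwardIso (frobeniusIter_preimage p hX N) _))) i
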